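/- Fix a non-square rational number $\Delta$. For a binary quadratic form $Q=lx^2+mxy+ry^2$ with rational coefficients put $\operatorname{disc}(Q)=m^2-4lr$. Two such forms are called $\mathbb{Q}$-equivalent if one is obtained from the other by a change of variables in $\mathrm{PSL}_2(\mathbb{Q})$ (acting through $\mathrm{SL}_2(\mathbb{Q})$, as $-1$ acts trivially). If $Q_a,Q_b$ both have discriminant $\Delta$, let $\alpha,\alpha'=\frac{-m_a\pm\sqrt{\Delta}}{2l_a}$ and $\beta,\beta'=\frac{-m_b\pm\sqrt{\Delta}}{2l_b}$ be their roots in $\mathbb{Q}(\sqrt\Delta)$ (with the same choice of $\sqrt\Delta$), and define their cross-ratio $$\operatorname{bir}(Q_a,Q_b)=\frac{(\alpha-\alpha')(\beta-\beta')}{(\alpha-\beta')(\beta-\alpha')}\in\mathbb{Q}\cup\{\infty\}.$$ Let $\mathcal{P}=\{-1\}\cup\{2,3,5,7,\dots\}$ be the set of places of $\mathbb{Q}$, with $\mathbb{Q}_{-1}=\mathbb{R}$. For $\delta,\chi\in\mathbb{Q}_p^\times$ the Hilbert symbol $(\delta,\chi)_p$ is $1$ if $x^2-\delta y^2=\chi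 z^2$ has a solution $(x,y,z)\neq(0,0,0)$ in $\mathbb{Q}_p^3$, and $-1$ otherwise. When $\operatorname{bir}(Q_a,Q_b)\neq\infty$, put $$\mathcal{P}(Q_a,Q_b)=\{p\in\mathcal{P} : (\Delta,\operatorname{bir}(Q_a,Q_b))_p=-1\}.$$ **Theorem.** Let $Q_a,Q_b$ be rational binary quadratic forms of discriminant $\Delta$. There are forms $Q_a',Q_b'$ which are $\mathbb{Q}$-equivalent to $Q_a$ and $Q_b$ respectively and satisfy $\operatorname{bir}(Q_a',Q_b')\neq\infty$. The set $\mathcal{P}(Q_a',Q_b')$ does not depend on the choice of such $Q_a',Q_b'$, and $Q_a$ and $Q_b$ are $\mathbb{Q}$-equivalent if and only if $\mathcal{P}(Q_a',Q_b')=\emptyset$, that is, if and only if $(\Delta,\operatorname{bir}(Q_a',Q_b'))_p=1$ for all $p\in\mathcal{P}$. In particular, if $\operatorname{bir}(Q_a,Q_b)\neq\infty$, then $Q_a$ and $Q_b$ are $\mathbb{Q}$-equivalent if and only if $\mathcal{P}(Q_a,Q_b)=\emptyset$. -/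

import Mathlib

/-- Binary quadratic forms over a field. -/
abbrev Qfb (F : Type) [Field F] : Type := QuadraticForm F (Fin 2 → F)

namespace Qfb

variable {F : Type} [Field F]

/-- The coefficient `l` of `Q = l x² + m x y + r y²`. -/
def l (Q : Qfb F) : F := Q ![1, 0]

/-- The coefficient `m` of `Q = l x² + m x y + r y²`. -/
def m (Q : Qfb F) : F := QuadraticMap.polar Q ![1, 0] ![0, 1]

/-- The coefficient `r` of `Q = l x² + m x y + r y²`. -/
def r (Q : Qfb F) : F := Q ![0, 1]

/-- The discriminant `m² - 4 l r`. -/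
def disc (Q : Qfb F) : F := Q.m ^ 2 - 4 * Q.l * Q.r

/-- Equivalence under `PSL₂(F)`, acting by change of variables. As `-1` acts trivially on quadratic
forms, the orbits of `PSL₂(F) = SL₂(F) / {±1}` are those of `SL₂(F)`. -/
def Equivalent (Q Q' : Qfb F) : Prop :=
  ∃ C : Matrix.SpecialLinearGroup (Fin 2) F,
    Q' = QuadraticMap.comp Q (Matrix.toLin' (C : Matrix (Fin 2) (Fin 2) F))

end Qfb

/-- The quadratic extension `ℚ(√Δ)`, with `√Δ = ⟨0, 1⟩`; it is a field when `Δ` is not a square. -/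
abbrev QSqrt (Δ : ℚ) : Type := QuadraticAlgebra ℚ Δ 0

theorem QSqrt.fact {Δ : ℚ} (hΔ : ¬ IsSquare Δ) : Fact (∀ x : ℚ, x ^ 2 ≠ Δ + 0 * x) :=
  ⟨fun x hx => hΔ ⟨x, by linear_combination -hx⟩⟩

section CrossRatio

open Classical in
/-- The cross-ratio `(α - α')(β - β') / ((α - β')(β - α'))` of `(α', α; β', β)`, where `α ≠ α'`
and `β ≠ β'`, as an element of `K ∪ {∞}`. -/
noncomputable def crossRatio {K : Type} [Field K] (α' α β' β : K) : OnePoint K :=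
  if (α - β') * (β - α') = 0 then OnePoint.infty
  else ((((α - α') * (β - β')) / ((α - β') * (β - α')) : K) : OnePoint K)

/-- The root `(-m + √Δ) / (2 l)` in `ℚ(√Δ)` of `l x² + m x + r`, for a form of discriminant `Δ`
(then `l ≠ 0`, as `Δ` is not a square). -/
def Qfb.root (Δ : ℚ) (Q : Qfb ℚ) : QSqrt Δ :=
  ⟨-Q.m / (2 * Q.l), 1 / (2 * Q.l)⟩

/-- The conjugate root `(-m - √Δ) / (2 l)`. -/
def Qfb.root' (Δ : ℚ) (Q : Qfb ℚ) : QSqrt Δ :=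
  ⟨-Q.m / (2 * Q.l), -1 / (2 * Q.l)⟩

variable {Δ : ℚ}

/-- The cross-ratio of the roots of two forms of the same discriminant `Δ`, in `ℚ(√Δ) ∪ {∞}`. -/
noncomputable def birSqrt (hΔ : ¬ IsSquare Δ) (Qa Qb : Qfb ℚ) : OnePoint (QSqrt Δ) :=
  haveI := QSqrt.fact hΔ
  crossRatio (Qa.root' Δ) (Qa.root Δ) (Qb.root' Δ) (Qb.root Δ)

/-- The cross-ratio `bir(Q_a, Q_b)` of two forms of the same non-square discriminant `Δ`, as an
element of `ℚ ∪ {∞}`: it lies there by `birSqrt_eq_map_bir` below. -/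
noncomputable def bir (hΔ : ¬ IsSquare Δ) (Qa Qb : Qfb ℚ) : OnePoint ℚ :=
  (birSqrt hΔ Qa Qb).map QuadraticAlgebra.re

theorem Qfb.l_ne_zero (hΔ : ¬ IsSquare Δ) {Q : Qfb ℚ} (h : Q.disc = Δ) : Q.l ≠ 0 := by
  intro h0
  exact hΔ ⟨Q.m, by rw [← h, Qfb.disc, h0]; ring⟩

theorem birSqrt_eq_map_bir (hΔ : ¬ IsSquare Δ) (Qa Qb : Qfb ℚ) (ha : Qa.disc = Δ)
    (hb : Qb.disc = Δ) :
    birSqrt hΔ Qa Qb = (bir hΔ Qa Qb).map (QuadraticAlgebra.C) := by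
  have hla := Qfb.l_ne_zero hΔ ha
  have hlb := Qfb.l_ne_zero hΔ hb
  let f : ℚ →+* QSqrt Δ := algebraMap ℚ (QSqrt Δ)
  have := QSqrt.fact hΔ
  have hn : (Qa.root Δ - Qa.root' Δ) * (Qb.root Δ - Qb.root' Δ)
      = QuadraticAlgebra.C (Δ / (Qa.l * Qb.l)) := by
    simp only [Qfb.root, Qfb.root']
    ext
    · simp only [QuadraticAlgebra.re_C, QuadraticAlgebra.re_mul, QuadraticAlgebra.re_sub,
        QuadraticAlgebra.im_sub]
      field_simp
      ring
    · simp only [QuadraticAlgebra.im_C, QuadraticAlgebra.im_mul, QuadraticAlgebra.re_sub,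
        QuadraticAlgebra.im_sub]
      ring
  have hd : (Qa.root Δ - Qb.root' Δ) * (Qb.root Δ - Qa.root' Δ)
      = QuadraticAlgebra.C ((Qa + Qb).disc / (4 * (Qa.l * Qb.l))) := by
    have hl : (Qa + Qb).l = Qa.l + Qb.l := rfl
    have hr : (Qa + Qb).r = Qa.r + Qb.r := rfl
    have hm : (Qa + Qb).m = Qa.m + Qb.m := QuadraticMap.polar_add _ _ _ _
    simp only [Qfb.root, Qfb.root']
    rw [Qfb.disc] at ha hb
    ext
    · simp only [QuadraticAlgebra.re_C, QuadraticAlgebra.re_mul, QuadraticAlgebra.re_sub,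
        QuadraticAlgebra.im_sub, Qfb.disc, hl, hr, hm]
      field_simp
      linear_combination 4 * (-Qb.l ^ 2 - Qa.l * Qb.l) * ha + 4 * (-Qa.l ^ 2 - Qa.l * Qb.l) * hb
    · simp only [QuadraticAlgebra.im_C, QuadraticAlgebra.im_mul, QuadraticAlgebra.re_sub,
        QuadraticAlgebra.im_sub]
      ring
  have hdiv : ∀ u v : ℚ, (QuadraticAlgebra.C u : QSqrt Δ) / QuadraticAlgebra.C v =
      QuadraticAlgebra.C (u / v) := fun u v => (map_div₀ f u v).symm
  have hB : ∃ χ : OnePoint ℚ, birSqrt hΔ Qa Qb = χ.map (QuadraticAlgebra.C) := by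
    unfold birSqrt crossRatio
    rw [hn, hd, hdiv]
    split_ifs
    · exact ⟨OnePoint.infty, rfl⟩
    · exact ⟨((_ : ℚ) : OnePoint ℚ), rfl⟩
  obtain ⟨χ, h⟩ := hB
  rw [bir, h]
  cases χ using OnePoint.rec <;> simp

end CrossRatio

open Classical in
/-- The Hilbert symbol `(δ, χ)` of a field, for `δ, χ ≠ 0`: it is `1` or `-1` according to whether
`x² - δ y² = χ z²` has a solution in the projective plane or not. -/
noncomputable def hilbertSymbol {K : Type} [Field K] (δ χ : K) : ℤ :=
  if ∃ x y z : K, (x, y, z) ≠ (0, 0, 0) ∧ x ^ 2 - δ * y ^ 2 = χ * z ^ 2 then 1 else -1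

/-- The places of `ℚ`: the prime `-1` (the real place) and the prime numbers. -/
inductive RatPlace : Type
  | minusOne : RatPlace
  | prime (p : ℕ) (hp : p.Prime) : RatPlace

/-- The Hilbert symbol `(δ, χ)_p` of the completion of `ℚ` at the place `p`. -/
noncomputable def RatPlace.hilbert (p : RatPlace) (δ χ : ℚ) : ℤ :=
  match p with
  | .minusOne => hilbertSymbol (δ : ℝ) (χ : ℝ)
  | .prime p hp =>
    haveI : Fact p.Prime := ⟨hp⟩
    hilbertSymbol (δ : ℚ_[p]) (χ : ℚ_[p])

/-- The set `P(Q_a, Q_b)` of the places `p` with `(Δ, bir(Q_a, Q_b))_p = -1`, for two forms of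
non-square discriminant `Δ` with `bir(Q_a, Q_b) ≠ ∞`. -/
def primeObstructions {Δ : ℚ} (hΔ : ¬ IsSquare Δ) (Qa Qb : Qfb ℚ) : Set RatPlace :=
  {p | ∃ χ : ℚ, bir hΔ Qa Qb = (χ : OnePoint ℚ) ∧ p.hilbert Δ χ = -1}

/-! Everything reduces to one class: `Qa.l * Qb.l` modulo norms from ℚ(√Δ). From 4lQ(x,y) = (2lx +
my)² - Δy², the values of a form lie in one norm class, and a form of discriminant Δ is determined
up to equivalence by any nonzero value; so `Qa` and `Qb` are equivalent iff x² - Δy² = l_a l_b z²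
has a rational point (`Qfb.equivalent_iff_conicSolvable`). By conjugation, bir = -4Δ l_a l_b / N
with N a norm (`bir_eq`); as -Δ is the norm of √Δ, bir and l_a l_b have the same Hilbert symbols
(`primeObstructions_eq`). The Hasse principle for conics, proved by Legendre's descent, ends the
argument. -/

/-! ### Conics and norms over a field. -/

section NormConic

variable {K : Type} [Field K]

/-- The conic `x² - a y² = b z²` has a `K`-rational point. -/
def ConicSolvable (K : Type) [Field K] (a b : K) : Prop :=
  ∃ x y z : K, (x, y, z) ≠ (0, 0, 0) ∧ x ^ 2 - a * y ^ 2 = b * z ^ 2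

theorem conicSolvable_comm {a b : K} : ConicSolvable K a b ↔ ConicSolvable K b a := by
  constructor <;>
  · rintro ⟨x, y, z, h, e⟩
    refine ⟨x, z, y, fun h' => h ?_, by linear_combination e⟩
    simp only [Prod.mk.injEq] at h' ⊢
    tauto

theorem conicSolvable_of_isSquare {a : K} (b : K) (h : IsSquare a) : ConicSolvable K a b := by
  obtain ⟨t, rfl⟩ := h
  exact ⟨t, 1, 0, by simp, by ring⟩

/-- Multiply x + y√a by u + v√a; this linear map of (x, y) has determinant u² - av², so the new
point is nonzero. -/
theorem ConicSolvable.mul_norm {a b : K} (h : ConicSolvable K a b) {u v : K}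
    (hn : u ^ 2 - a * v ^ 2 ≠ 0) : ConicSolvable K a (b * (u ^ 2 - a * v ^ 2)) := by
  obtain ⟨x, y, z, h0, e⟩ := h
  refine ⟨x * u + a * y * v, x * v + y * u, z, fun h' => h0 ?_, by
    linear_combination (u ^ 2 - a * v ^ 2) * e⟩
  simp only [Prod.mk.injEq] at h' ⊢
  obtain ⟨h1, h2, h3⟩ := h'
  refine ⟨?_, ?_, h3⟩
  · exact (mul_eq_zero.mp (show x * (u ^ 2 - a * v ^ 2) = 0 by
      linear_combination u * h1 - a * v * h2)).resolve_right hn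
  · exact (mul_eq_zero.mp (show y * (u ^ 2 - a * v ^ 2) = 0 by
      linear_combination u * h2 - v * h1)).resolve_right hn

theorem conicSolvable_mul_norm_iff {a b u v : K} (hn : u ^ 2 - a * v ^ 2 ≠ 0) :
    ConicSolvable K a (b * (u ^ 2 - a * v ^ 2)) ↔ ConicSolvable K a b := by
  refine ⟨fun h => ?_, fun h => h.mul_norm hn⟩
  have e : (u / (u ^ 2 - a * v ^ 2)) ^ 2 - a * (v / (u ^ 2 - a * v ^ 2)) ^ 2
      = (u ^ 2 - a * v ^ 2)⁻¹ := by
    field_simp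
  have := h.mul_norm (u := u / (u ^ 2 - a * v ^ 2)) (v := v / (u ^ 2 - a * v ^ 2))
    (by rw [e]; exact inv_ne_zero hn)
  rwa [e, mul_inv_cancel_right₀ hn] at this

theorem conicSolvable_mul_sq_iff {a b c : K} (hc : c ≠ 0) :
    ConicSolvable K a (b * c ^ 2) ↔ ConicSolvable K a b := by
  simpa using conicSolvable_mul_norm_iff (a := a) (b := b) (u := c) (v := 0) (by simpa using hc)

/-- The descent step: b and b' agree modulo norms since b'b² = b(t² - a). It serves locally from b
to b' and globally back. -/
theorem ConicSolvable.of_mul_eq {a b b' t : K} (h : ConicSolvable K a b) (hb : b ≠ 0)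
    (hb' : b' ≠ 0) (e : t ^ 2 - a = b * b') : ConicSolvable K a b' := by
  rw [← conicSolvable_mul_sq_iff hb, show b' * b ^ 2 = b * (t ^ 2 - a * 1 ^ 2) by
    linear_combination -b * e]
  exact h.mul_norm (by rw [one_pow, mul_one, e]; exact mul_ne_zero hb hb')

end NormConic

/-! ### The Hasse principle by Legendre's descent. -/

section Hasse

/-- Solvability of `x² - a y² = b z²` over every completion of `ℚ`. -/
def EverywhereSolvable (a b : ℚ) : Prop :=
  ConicSolvable ℝ a b ∧ ∀ (p : ℕ) [Fact p.Prime], ConicSolvable ℚ_[p] a b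

theorem everywhereSolvable_comm {a b : ℚ} : EverywhereSolvable a b ↔ EverywhereSolvable b a :=
  and_congr conicSolvable_comm (forall₂_congr fun _ _ => conicSolvable_comm)

theorem everywhereSolvable_mul_sq_iff {a b c : ℚ} (hc : c ≠ 0) :
    EverywhereSolvable a (b * c ^ 2) ↔ EverywhereSolvable a b := by
  unfold EverywhereSolvable
  push_cast
  refine and_congr (conicSolvable_mul_sq_iff (by exact_mod_cast hc))
    (forall₂_congr fun _ _ => conicSolvable_mul_sq_iff (by exact_mod_cast hc))

theorem EverywhereSolvable.of_mul_eq {a b b' t : ℚ} (h : EverywhereSolvable a b) (hb : b ≠ 0)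
    (hb' : b' ≠ 0) (e : t ^ 2 - a = b * b') : EverywhereSolvable a b' :=
  ⟨h.1.of_mul_eq (t := (t : ℝ)) (by exact_mod_cast hb) (by exact_mod_cast hb')
    (by exact_mod_cast e),
   fun p _ => (h.2 p).of_mul_eq (t := (t : ℚ_[p])) (by exact_mod_cast hb) (by exact_mod_cast hb')
    (by exact_mod_cast e)⟩

/-- A projective point over `ℚ_p` has primitive coordinates in `ℤ_p`. -/
theorem Padic.exists_primitive_coordinates {p : ℕ} [Fact p.Prime] {x y z : ℚ_[p]}
    (h : (x, y, z) ≠ (0, 0, 0)) :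
    ∃ (c : ℚ_[p]) (x' y' z' : ℤ_[p]), c ≠ 0 ∧ x = c * x' ∧ y = c * y' ∧ z = c * z' ∧
      ¬ ((p : ℤ_[p]) ∣ x' ∧ (p : ℤ_[p]) ∣ y' ∧ (p : ℤ_[p]) ∣ z') := by
  -- Dividing by a coordinate of largest norm makes all of them integral and one equal to 1.
  have key : ∃ c : ℚ_[p], c ≠ 0 ∧ (c = x ∨ c = y ∨ c = z) ∧ ‖x‖ ≤ ‖c‖ ∧ ‖y‖ ≤ ‖c‖ ∧ ‖z‖ ≤ ‖c‖ := by
    have h0 : ∃ c : ℚ_[p], (c = x ∨ c = y ∨ c = z) ∧ ‖x‖ ≤ ‖c‖ ∧ ‖y‖ ≤ ‖c‖ ∧ ‖z‖ ≤ ‖c‖ := by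
      rcases le_total ‖x‖ ‖y‖ with h1 | h1 <;> rcases le_total ‖y‖ ‖z‖ with h2 | h2 <;>
        rcases le_total ‖x‖ ‖z‖ with h3 | h3
      all_goals first
        | exact ⟨x, by simp, by simp, by assumption, by assumption⟩
        | exact ⟨y, by simp, by assumption, by simp, by assumption⟩
        | exact ⟨z, by simp, by assumption, by assumption, by simp⟩
        | exact ⟨z, by simp, h1.trans h2, by assumption, by simp⟩
        | exact ⟨x, by simp, by simp, by assumption, h2.trans h1⟩
    obtain ⟨c, hc, hx, hy, hz⟩ := h0
    refine ⟨c, ?_, hc, hx, hy, hz⟩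
    rintro rfl
    apply h
    simp_all
  obtain ⟨c, hc, hor, hx, hy, hz⟩ := key
  have hd : ∀ w : ℚ_[p], ‖w‖ ≤ ‖c‖ → ‖w / c‖ ≤ 1 := fun w hw => by
    rw [norm_div]
    exact div_le_one_of_le₀ hw (norm_nonneg _)
  refine ⟨c, ⟨x / c, hd x hx⟩, ⟨y / c, hd y hy⟩, ⟨z / c, hd z hz⟩, hc, ?_, ?_, ?_, ?_⟩
  · field_simp
  · field_simp
  · field_simp
  · have hu : ∀ w (hw : ‖w / c‖ ≤ 1), c = w → ¬ (p : ℤ_[p]) ∣ ⟨w / c, hw⟩ := by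
      rintro w hw rfl hdvd
      have h1 : ∀ w : ℤ_[p], (w : ℚ_[p]) = 1 → w = 1 := fun w h => Subtype.ext h
      rw [h1 ⟨c / c, hw⟩ (div_self hc)] at hdvd
      exact PadicInt.prime_p.not_isUnit (isUnit_of_dvd_one hdvd)
    rintro ⟨h1, h2, h3⟩
    rcases hor with e | e | e
    · exact hu _ _ e h1
    · exact hu _ _ e h2
    · exact hu _ _ e h3

/-- Reduce a primitive solution mod p: x² ≡ ay² with y a unit. -/
theorem exists_prime_dvd_sq_sub {p : ℕ} [Fact p.Prime] {a b : ℤ} (hb : (p : ℤ) ∣ b)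
    (hb2 : ¬ (p : ℤ) * p ∣ b) (h : ConicSolvable ℚ_[p] a b) : ∃ t : ℤ, (p : ℤ) ∣ t ^ 2 - a := by
  obtain ⟨x, y, z, h0, e⟩ := h
  obtain ⟨c, x', y', z', hc, rfl, rfl, rfl, hprim⟩ := Padic.exists_primitive_coordinates h0
  have hp : Prime (p : ℤ_[p]) := PadicInt.prime_p
  have e' : x' ^ 2 - a * y' ^ 2 = b * z' ^ 2 := by
    have : (x' : ℚ_[p]) ^ 2 - a * (y' : ℚ_[p]) ^ 2 = b * (z' : ℚ_[p]) ^ 2 := by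
      refine mul_left_cancel₀ (pow_ne_zero 2 hc) ?_
      linear_combination e
    refine Subtype.ext ?_
    push_cast
    exact this
  obtain ⟨k, rfl⟩ := hb
  have hk : ¬ (p : ℤ_[p]) ∣ (k : ℤ_[p]) := by
    intro hd
    rw [← PadicInt.norm_lt_one_iff_dvd, PadicInt.norm_int_lt_one_iff_dvd] at hd
    exact hb2 (mul_dvd_mul_left _ hd)
  push_cast at e'
  -- If p ∣ y then p ∣ x, so p² ∣ bz²; as p divides b only once, p ∣ z, against primitivity.
  have hy : ¬ (p : ℤ_[p]) ∣ y' := by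
    intro hy
    have hx : (p : ℤ_[p]) ∣ x' := by
      refine hp.dvd_of_dvd_pow (n := 2) ?_
      rw [show x' ^ 2 = a * y' ^ 2 + p * (k * z' ^ 2) by linear_combination e']
      exact dvd_add ((dvd_pow hy two_ne_zero).mul_left _) (dvd_mul_right _ _)
    refine hprim ⟨hx, hy, ?_⟩
    obtain ⟨x₁, rfl⟩ := hx
    obtain ⟨y₁, rfl⟩ := hy
    have : (k : ℤ_[p]) * z' ^ 2 = p * (x₁ ^ 2 - a * y₁ ^ 2) := by
      refine mul_left_cancel₀ hp.ne_zero ?_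
      linear_combination -e'
    exact hp.dvd_of_dvd_pow ((hp.dvd_or_dvd ⟨_, this⟩).resolve_left hk)
  let φ : ℤ_[p] →+* ZMod p := PadicInt.toZMod
  have hφp : φ p = 0 := by simp
  have hφy : φ y' ≠ 0 := by
    intro h
    apply hy
    rw [← PadicInt.norm_lt_one_iff_dvd, ← PadicInt.mem_nonunits,
      ← IsLocalRing.mem_maximalIdeal, ← PadicInt.ker_toZMod]
    exact h
  have e2 := congrArg φ e'
  simp only [map_sub, map_mul, map_pow, hφp, map_intCast] at e2
  obtain ⟨t, ht⟩ := ZMod.intCast_surjective (φ x' / φ y')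
  refine ⟨t, ?_⟩
  rw [← ZMod.intCast_zmod_eq_zero_iff_dvd]
  push_cast
  rw [ht]
  field_simp
  linear_combination e2

theorem exists_squarefree_dvd_sq_sub {a : ℤ} (n : ℕ) (hn : Squarefree n)
    (h : ∀ p : ℕ, p.Prime → p ∣ n → ∃ t : ℤ, (p : ℤ) ∣ t ^ 2 - a) :
    ∃ t : ℤ, (n : ℤ) ∣ t ^ 2 - a := by
  induction n using induction_on_primes with
  | zero => exact absurd hn not_squarefree_zero
  | one => exact ⟨0, by simp⟩
  | prime_mul p m hp ih =>
    obtain ⟨t₁, h1⟩ := h p hp (dvd_mul_right _ _)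
    obtain ⟨t₂, h2⟩ := ih hn.of_mul_right fun q hq hqm => h q hq (hqm.mul_left _)
    obtain ⟨hcop, -, -⟩ := Nat.squarefree_mul_iff.mp hn
    have hcop' : IsCoprime (p : ℤ) m := Nat.isCoprime_iff_coprime.mpr hcop
    obtain ⟨u, v, huv⟩ := id hcop'
    -- Chinese remainder: congruent to t₁ mod p and to t₂ mod m.
    refine ⟨t₁ * (v * m) + t₂ * (u * p), ?_⟩
    push_cast
    refine hcop'.mul_dvd ?_ ?_
    · rw [show (t₁ * (v * m) + t₂ * (u * p)) ^ 2 - a = (t₁ ^ 2 - a) +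
        p * (u * (t₂ - t₁) * (2 * t₁ + u * p * (t₂ - t₁))) by
          rw [show v * (m : ℤ) = 1 - u * p by linear_combination huv]; ring]
      exact dvd_add h1 (dvd_mul_right _ _)
    · rw [show (t₁ * (v * m) + t₂ * (u * p)) ^ 2 - a = (t₂ ^ 2 - a) +
        m * (v * (t₁ - t₂) * (2 * t₂ + v * m * (t₁ - t₂))) by
          rw [show u * (p : ℤ) = 1 - v * m by linear_combination huv]; ring]
      exact dvd_add h2 (dvd_mul_right _ _)

/-- With the centred residue |s| ≤ |b|/2, one gets |b'| ≤ |b|/4 + 1 < |b| as soon as |b| ≥ 2. -/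
theorem exists_sq_sub_eq_mul_lt {a b : ℤ} (hb : 2 ≤ b.natAbs) (hab : a.natAbs ≤ b.natAbs)
    (h : ∃ t : ℤ, b ∣ t ^ 2 - a) : ∃ t b' : ℤ, t ^ 2 - a = b * b' ∧ b'.natAbs < b.natAbs := by
  obtain ⟨t, ht⟩ := h
  set s := t.bmod b.natAbs with hs
  have hst : b ∣ s ^ 2 - a := by
    have : b ∣ s - t := Int.natAbs_dvd.mp (Int.modEq_iff_dvd.mp (Int.bmod_emod ..).symm)
    have h2 := dvd_add (this.mul_right (s + t)) ht
    rwa [show (s - t) * (s + t) + (t ^ 2 - a) = s ^ 2 - a by ring] at h2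
  obtain ⟨b', hb'⟩ := hst
  refine ⟨s, b', hb', ?_⟩
  have h1 : s < (b.natAbs + 1) / 2 := Int.bmod_lt (by omega)
  have h2 : -(b.natAbs / 2 : ℤ) ≤ s := Int.le_bmod (by omega)
  have hs2 : 2 * |s| ≤ |b| := by rw [Int.abs_eq_natAbs, Int.abs_eq_natAbs]; omega
  have ha : |a| ≤ |b| := by rw [Int.abs_eq_natAbs, Int.abs_eq_natAbs]; omega
  have hb2 : 2 ≤ |b| := by rw [Int.abs_eq_natAbs]; omega
  have h3 : |b| * |b'| ≤ |s| ^ 2 + |a| := by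
    rw [← abs_mul, ← hb', ← abs_pow]
    exact abs_sub _ _
  have : |b'| < |b| := by
    by_contra hcon
    push Not at hcon
    nlinarith [abs_nonneg s, mul_le_mul hs2 hs2 (by positivity) (by positivity),
      mul_le_mul_of_nonneg_left hcon (abs_nonneg b)]
  rwa [Int.abs_eq_natAbs, Int.abs_eq_natAbs, Nat.cast_lt] at this

/-- Descent on |a| + |b|, with |a| ≤ |b| by symmetry: strip a square factor from b, or, if b is
squarefree, replace it by a smaller b' with t² - a = bb'. -/
theorem EverywhereSolvable.conicSolvable_int (n : ℕ) : ∀ a b : ℤ, a ≠ 0 → b ≠ 0 →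
    a.natAbs + b.natAbs ≤ n → EverywhereSolvable a b → ConicSolvable ℚ a b := by
  induction n with
  | zero => intro a b ha hb hn; omega
  | succ n ih =>
  suffices H : ∀ a b : ℤ, a ≠ 0 → b ≠ 0 → a.natAbs ≤ b.natAbs → a.natAbs + b.natAbs ≤ n + 1 →
      EverywhereSolvable a b → ConicSolvable ℚ a b by
    intro a b ha hb hn h
    rcases le_total a.natAbs b.natAbs with hab | hab
    · exact H a b ha hb hab hn h
    · exact conicSolvable_comm.mp (H b a hb ha hab (by omega) (everywhereSolvable_comm.mp h))
  intro a b ha hb hab hn h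
  by_cases hb1 : b.natAbs ≤ 1
  · have ha' : a = 1 ∨ a = -1 := by omega
    have hb' : b = 1 ∨ b = -1 := by omega
    rcases ha' with rfl | rfl
    · exact conicSolvable_of_isSquare _ ⟨1, by simp⟩
    rcases hb' with rfl | rfl
    · exact conicSolvable_comm.mp (conicSolvable_of_isSquare _ ⟨1, by simp⟩)
    -- For a = b = -1 the real place gives x² + y² + z² = 0.
    obtain ⟨x, y, z, h0, e⟩ := h.1
    push_cast at e
    refine absurd ?_ h0
    have hx : x = 0 := by nlinarith [sq_nonneg x, sq_nonneg y, sq_nonneg z]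
    have hy : y = 0 := by nlinarith [sq_nonneg x, sq_nonneg y, sq_nonneg z]
    have hz : z = 0 := by nlinarith [sq_nonneg x, sq_nonneg y, sq_nonneg z]
    rw [hx, hy, hz]
  by_cases hsq : Squarefree b.natAbs
  · have hroot : ∃ t : ℤ, b ∣ t ^ 2 - a := by
      obtain ⟨t, ht⟩ := exists_squarefree_dvd_sq_sub (a := a) b.natAbs hsq fun p hp hpb => by
        have := Fact.mk hp
        refine exists_prime_dvd_sq_sub (b := b) (Int.natCast_dvd.mpr hpb) (fun hpp => ?_)
          (by simpa using h.2 p)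
        have : p * p ∣ b.natAbs := Int.natCast_dvd.mp (by exact_mod_cast hpp)
        exact hp.not_isUnit (hsq p this)
      exact ⟨t, Int.natAbs_dvd.mp ht⟩
    obtain ⟨t, b', e, hlt⟩ := exists_sq_sub_eq_mul_lt (by omega) hab hroot
    by_cases hb' : b' = 0
    · exact conicSolvable_of_isSquare _ ⟨t, by
        rw [hb', mul_zero, sub_eq_zero] at e
        rw [← e]; push_cast; ring⟩
    · have e' : (t : ℚ) ^ 2 - a = b * b' := by exact_mod_cast e
      have hbQ : (b : ℚ) ≠ 0 := by exact_mod_cast hb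
      have hbQ' : (b' : ℚ) ≠ 0 := by exact_mod_cast hb'
      refine (ih a b' ha hb' (by omega) (h.of_mul_eq hbQ hbQ' e')).of_mul_eq hbQ' hbQ
        (t := (t : ℚ)) ?_
      rw [e', mul_comm]
  · obtain ⟨p, hp, k, hk⟩ : ∃ p : ℕ, p.Prime ∧ p * p ∣ b.natAbs := by
      simpa [Nat.squarefree_iff_prime_squarefree] using hsq
    obtain ⟨c, rfl⟩ : ((p : ℤ) * p) ∣ b := by
      rw [← Int.dvd_natAbs]; exact ⟨k, by exact_mod_cast hk⟩
    have hp0 : (p : ℚ) ≠ 0 := by exact_mod_cast hp.ne_zero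
    have hc : c ≠ 0 := right_ne_zero_of_mul hb
    have ec : (((p : ℤ) * p * c : ℤ) : ℚ) = c * (p : ℚ) ^ 2 := by push_cast; ring
    rw [ec] at h ⊢
    rw [conicSolvable_mul_sq_iff hp0]
    rw [everywhereSolvable_mul_sq_iff hp0] at h
    refine ih a c ha hc ?_ h
    have hlt : c.natAbs < ((p : ℤ) * p * c).natAbs := by
      rw [Int.natAbs_mul]
      refine lt_mul_left (Int.natAbs_pos.mpr hc) ?_
      simpa [Int.natAbs_mul] using Nat.one_lt_mul_iff.mpr
        ⟨hp.pos, hp.pos, Or.inl hp.one_lt⟩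
    omega

/-- The Hasse principle for the conics `x² - a y² = b z²` over `ℚ`. -/
theorem EverywhereSolvable.conicSolvable {a b : ℚ} (ha : a ≠ 0) (hb : b ≠ 0)
    (h : EverywhereSolvable a b) : ConicSolvable ℚ a b := by
  have key : ∀ q : ℚ, ((q.num * q.den : ℤ) : ℚ) = q * (q.den : ℚ) ^ 2 := fun q => by
    push_cast
    rw [pow_two, ← mul_assoc, Rat.mul_den_eq_num]
  have hda : (a.den : ℚ) ≠ 0 := by exact_mod_cast a.den_ne_zero
  have hdb : (b.den : ℚ) ≠ 0 := by exact_mod_cast b.den_ne_zero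
  have := EverywhereSolvable.conicSolvable_int _ (a.num * a.den) (b.num * b.den)
    (mul_ne_zero (Rat.num_ne_zero.mpr ha) (by exact_mod_cast a.den_ne_zero))
    (mul_ne_zero (Rat.num_ne_zero.mpr hb) (by exact_mod_cast b.den_ne_zero)) le_rfl
  rw [key a, key b, everywhereSolvable_mul_sq_iff hdb, everywhereSolvable_comm,
    everywhereSolvable_mul_sq_iff hda, everywhereSolvable_comm, conicSolvable_mul_sq_iff hdb,
    conicSolvable_comm, conicSolvable_mul_sq_iff hda, conicSolvable_comm] at this
  exact this h

end Hasse
-- Hilbert symbols and norms.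
theorem ConicSolvable.map {K L : Type} [Field K] [Field L] (f : K →+* L) {a b : K}
    (h : ConicSolvable K a b) : ConicSolvable L (f a) (f b) := by
  obtain ⟨x, y, z, h0, e⟩ := h
  refine ⟨f x, f y, f z, by simpa using h0, ?_⟩
  simpa using congrArg f e

theorem conicSolvable_iff_everywhereSolvable {a b : ℚ} (ha : a ≠ 0) (hb : b ≠ 0) :
    ConicSolvable ℚ a b ↔ EverywhereSolvable a b :=
  ⟨fun h => ⟨h.map (Rat.castHom ℝ), fun p _ => h.map (Rat.castHom ℚ_[p])⟩,
    fun h => h.conicSolvable ha hb⟩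

theorem hilbertSymbol_eq_neg_one_iff {K : Type} [Field K] {a b : K} :
    hilbertSymbol a b = -1 ↔ ¬ ConicSolvable K a b := by
  by_cases h : ConicSolvable K a b
  · have e : hilbertSymbol a b = 1 := if_pos h
    simp [h, e]
  · have e : hilbertSymbol a b = -1 := if_neg h
    simp [h, e]

theorem RatPlace.hilbert_mul_norm (p : RatPlace) {a b u v : ℚ} (hn : u ^ 2 - a * v ^ 2 ≠ 0) :
    p.hilbert a (b * (u ^ 2 - a * v ^ 2)) = -1 ↔ p.hilbert a b = -1 := by
  cases p with
  | minusOne =>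
    simp only [RatPlace.hilbert, hilbertSymbol_eq_neg_one_iff]
    push_cast
    rw [conicSolvable_mul_norm_iff (by exact_mod_cast hn)]
  | prime p hp =>
    have := Fact.mk hp
    simp only [RatPlace.hilbert, hilbertSymbol_eq_neg_one_iff]
    push_cast
    rw [conicSolvable_mul_norm_iff (by exact_mod_cast hn)]

theorem everywhereSolvable_iff_hilbert {a b : ℚ} :
    EverywhereSolvable a b ↔ ∀ p : RatPlace, ¬ p.hilbert a b = -1 := by
  refine ⟨fun h p => ?_, fun h => ⟨?_, fun p hp => ?_⟩⟩
  · cases p with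
    | minusOne => simpa only [RatPlace.hilbert, hilbertSymbol_eq_neg_one_iff, not_not] using h.1
    | prime p hp =>
      have := Fact.mk hp
      simpa only [RatPlace.hilbert, hilbertSymbol_eq_neg_one_iff, not_not] using h.2 p
  · simpa only [RatPlace.hilbert, hilbertSymbol_eq_neg_one_iff, not_not] using h .minusOne
  · simpa only [RatPlace.hilbert, hilbertSymbol_eq_neg_one_iff, not_not] using h (.prime p hp.out)

theorem conicSolvable_iff_exists_norm {K : Type} [Field K] {a b : K} (ha : ¬ IsSquare a) :
    ConicSolvable K a b ↔ ∃ x y : K, x ^ 2 - a * y ^ 2 = b := by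
  refine ⟨?_, fun ⟨x, y, e⟩ => ⟨x, y, 1, by simp, by rw [e]; ring⟩⟩
  rintro ⟨x, y, z, h0, e⟩
  by_cases hz : z = 0
  · subst hz
    by_cases hy : y = 0
    · subst hy
      have : x = 0 := by simpa using e
      simp [this] at h0
    · exact absurd ⟨x / y, by field_simp; linear_combination -e⟩ ha
  · exact ⟨x / z, y / z, by field_simp; linear_combination e⟩

theorem sq_sub_mul_sq_ne_zero {K : Type} [Field K] {a x y : K} (ha : ¬ IsSquare a)
    (h : (x, y) ≠ (0, 0)) : x ^ 2 - a * y ^ 2 ≠ 0 := by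
  intro e
  by_cases hy : y = 0
  · subst hy
    have : x = 0 := by simpa using e
    simp [this] at h
  · exact ha ⟨x / y, by field_simp; linear_combination -e⟩

/-! ### Equivalence of forms and represented values. -/

namespace Qfb

variable {F : Type} [Field F]

theorem apply_eq (Q : Qfb F) (x y : F) : Q ![x, y] = Q.l * x ^ 2 + Q.m * x * y + Q.r * y ^ 2 := by
  have h : (![x, y] : Fin 2 → F) = x • ![1, 0] + y • ![0, 1] := by
    ext i; fin_cases i <;> simp
  rw [h, QuadraticMap.map_add Q, QuadraticMap.map_smul, QuadraticMap.map_smul,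
    QuadraticMap.polar_smul_left, QuadraticMap.polar_smul_right]
  simp only [smul_eq_mul, l, m, r]
  ring

theorem ext_coeff {Q Q' : Qfb F} (hl : Q.l = Q'.l) (hm : Q.m = Q'.m) (hr : Q.r = Q'.r) :
    Q = Q' := by
  ext v
  have hv : v = ![v 0, v 1] := by ext i; fin_cases i <;> rfl
  rw [hv, apply_eq, apply_eq, hl, hm, hr]

theorem m_eq (Q : Qfb F) : Q.m = Q ![1, 1] - Q.l - Q.r := by
  rw [apply_eq]; ring

section comp

variable (Q : Qfb F) (C : Matrix (Fin 2) (Fin 2) F)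

theorem comp_apply (x y : F) : Q.comp (Matrix.toLin' C) ![x, y] =
    Q ![C 0 0 * x + C 0 1 * y, C 1 0 * x + C 1 1 * y] := by
  rw [QuadraticMap.comp_apply]
  congr 1
  ext i; fin_cases i <;> simp [Matrix.mulVec, dotProduct, Fin.sum_univ_two]

theorem l_comp : l (Q.comp (Matrix.toLin' C)) = Q ![C 0 0, C 1 0] := by
  simp [l]

theorem r_comp : r (Q.comp (Matrix.toLin' C)) = Q ![C 0 1, C 1 1] := by
  simp [r]

theorem m_comp : m (Q.comp (Matrix.toLin' C)) = 2 * Q.l * C 0 0 * C 0 1 +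
    Q.m * (C 0 0 * C 1 1 + C 0 1 * C 1 0) + 2 * Q.r * C 1 0 * C 1 1 := by
  rw [m_eq, l_comp, r_comp, comp_apply]
  simp only [apply_eq]
  ring

theorem disc_comp : disc (Q.comp (Matrix.toLin' C)) = Q.disc * C.det ^ 2 := by
  simp only [disc, l_comp, m_comp, r_comp, apply_eq, Matrix.det_fin_two]
  ring

end comp

theorem Equivalent.disc_eq {Q Q' : Qfb F} (h : Q.Equivalent Q') : Q'.disc = Q.disc := by
  obtain ⟨C, rfl⟩ := h
  rw [disc_comp, C.det_coe, one_pow, mul_one]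

theorem Equivalent.refl (Q : Qfb F) : Q.Equivalent Q :=
  ⟨1, by ext; simp⟩

/-- A form represents the leading coefficient times norms. -/
theorem four_mul_l_mul_apply (Q : Qfb F) (x y : F) :
    4 * Q.l * Q ![x, y] = (2 * Q.l * x + Q.m * y) ^ 2 - Q.disc * y ^ 2 := by
  rw [apply_eq, disc]; ring

/-- Complete (x, y) to a unimodular basis; a shear adjusts the middle coefficient, and the
discriminant then forces the last one. -/
theorem equivalent_of_represents [NeZero (2 : F)] {Q Q' : Qfb F} (hd : Q'.disc = Q.disc)
    (hl : Q'.l ≠ 0) {x y : F} (h : Q ![x, y] = Q'.l) : Q.Equivalent Q' := by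
  have h2 : (2 : F) ≠ 0 := NeZero.ne 2
  obtain ⟨u, v, huv⟩ : ∃ u v : F, x * v - u * y = 1 := by
    by_cases hx : x = 0
    · by_cases hy : y = 0
      · rw [apply_eq, hx, hy] at h
        exact absurd (by rw [← h]; ring) hl
      · exact ⟨-y⁻¹, 0, by field_simp; ring⟩
    · exact ⟨0, x⁻¹, by field_simp; ring⟩
  set m₀ : F := 2 * Q.l * x * u + Q.m * (x * v + u * y) + 2 * Q.r * y * v with hm₀
  -- Adding k times the first column to the second raises the middle coefficient by 2k `Q'.l`.
  set k : F := (Q'.m - m₀) / (2 * Q'.l) with hk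
  let C : Matrix.SpecialLinearGroup (Fin 2) F :=
    ⟨!![x, u + k * x; y, v + k * y], by
      rw [Matrix.det_fin_two_of]; linear_combination huv⟩
  have hlC : l (Q.comp (Matrix.toLin' (C : Matrix (Fin 2) (Fin 2) F))) = Q'.l := by
    rw [l_comp]; exact h
  have hmC : m (Q.comp (Matrix.toLin' (C : Matrix (Fin 2) (Fin 2) F))) = Q'.m := by
    rw [m_comp]
    change 2 * Q.l * x * (u + k * x) + Q.m * (x * (v + k * y) + (u + k * x) * y) +
      2 * Q.r * y * (v + k * y) = Q'.m
    rw [apply_eq] at h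
    have : k * (2 * Q'.l) = Q'.m - m₀ := div_mul_cancel₀ _ (mul_ne_zero h2 hl)
    linear_combination this + 2 * k * h
  refine ⟨C, (ext_coeff hlC hmC ?_).symm⟩
  have hdC := (Equivalent.disc_eq (Q := Q) ⟨C, rfl⟩).trans hd.symm
  rw [disc, disc, hlC, hmC] at hdC
  refine mul_left_cancel₀ (mul_ne_zero (mul_ne_zero h2 h2) hl) ?_
  linear_combination -hdC

theorem Equivalent.exists_l_eq {Δ : ℚ} (hΔ : ¬ IsSquare Δ) {Q Q' : Qfb ℚ} (hd : Q.disc = Δ)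
    (h : Q.Equivalent Q') :
    ∃ u v : ℚ, u ^ 2 - Δ * v ^ 2 ≠ 0 ∧ Q'.l = Q.l * (u ^ 2 - Δ * v ^ 2) := by
  have hl := l_ne_zero hΔ hd
  have hl' := l_ne_zero hΔ (h.disc_eq.trans hd)
  obtain ⟨C, rfl⟩ := h
  rw [l_comp] at hl' ⊢
  have e := four_mul_l_mul_apply Q (C 0 0) (C 1 0)
  rw [hd] at e
  have e' : Q ![C 0 0, C 1 0] = Q.l * (((2 * Q.l * C 0 0 + Q.m * C 1 0) / (2 * Q.l)) ^ 2 -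
      Δ * (C 1 0 / (2 * Q.l)) ^ 2) := by
    field_simp
    linear_combination e
  exact ⟨_, _, right_ne_zero_of_mul (e' ▸ hl'), e'⟩

theorem equivalent_iff_conicSolvable {Δ : ℚ} (hΔ : ¬ IsSquare Δ) {Qa Qb : Qfb ℚ}
    (ha : Qa.disc = Δ) (hb : Qb.disc = Δ) :
    Qa.Equivalent Qb ↔ ConicSolvable ℚ Δ (Qa.l * Qb.l) := by
  have hla := l_ne_zero hΔ ha
  have hlb := l_ne_zero hΔ hb
  rw [conicSolvable_iff_exists_norm hΔ]
  constructor
  · intro h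
    obtain ⟨u, v, -, e⟩ := h.exists_l_eq hΔ ha
    exact ⟨Qa.l * u, Qa.l * v, by rw [e]; ring⟩
  · rintro ⟨s, t, e⟩
    -- The witness solves 2l_a x + m_a y = 2s, y = 2t.
    refine equivalent_of_represents (hb.trans ha.symm) hlb
      (x := (s - Qa.m * t) / Qa.l) (y := 2 * t) ?_
    refine mul_left_cancel₀ (mul_ne_zero four_ne_zero hla) ?_
    rw [four_mul_l_mul_apply, ha]
    have : Qa.l * ((s - Qa.m * t) / Qa.l) = s - Qa.m * t := mul_div_cancel₀ _ hla
    rw [mul_assoc 2, this]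
    linear_combination 4 * e

end Qfb

/-! ### The cross-ratio modulo norms. -/

section Cross

variable {Δ : ℚ} (hΔ : ¬ IsSquare Δ) {Qa Qb : Qfb ℚ}

/-- The norm of `2 l_a l_b (α - β')`, up to sign. -/
def conjRootsNorm (Δ : ℚ) (Qa Qb : Qfb ℚ) : ℚ :=
  (Qb.m * Qa.l - Qa.m * Qb.l) ^ 2 - Δ * (Qa.l + Qb.l) ^ 2

/-- The conjugate of α - β' is -(β - α'), so the denominator of the cross-ratio is minus a norm. -/
theorem bir_eq (ha : Qa.disc = Δ) (hb : Qb.disc = Δ) :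
    bir hΔ Qa Qb = if conjRootsNorm Δ Qa Qb = 0 then OnePoint.infty else
      ((-4 * Δ * (Qa.l * Qb.l) / conjRootsNorm Δ Qa Qb : ℚ) : OnePoint ℚ) := by
  have hla := Qfb.l_ne_zero hΔ ha
  have hlb := Qfb.l_ne_zero hΔ hb
  let f : ℚ →+* QSqrt Δ := algebraMap ℚ (QSqrt Δ)
  have := QSqrt.fact hΔ
  have hn : (Qa.root Δ - Qa.root' Δ) * (Qb.root Δ - Qb.root' Δ)
      = QuadraticAlgebra.C (Δ / (Qa.l * Qb.l)) := by
    simp only [Qfb.root, Qfb.root']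
    ext
    · simp only [QuadraticAlgebra.re_C, QuadraticAlgebra.re_mul, QuadraticAlgebra.re_sub,
        QuadraticAlgebra.im_sub]
      field_simp
      ring
    · simp only [QuadraticAlgebra.im_C, QuadraticAlgebra.im_mul, QuadraticAlgebra.re_sub,
        QuadraticAlgebra.im_sub]
      ring
  have hd : (Qa.root Δ - Qb.root' Δ) * (Qb.root Δ - Qa.root' Δ)
      = QuadraticAlgebra.C (-conjRootsNorm Δ Qa Qb / (4 * (Qa.l * Qb.l) ^ 2)) := by
    simp only [Qfb.root, Qfb.root', conjRootsNorm]
    ext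
    · simp only [QuadraticAlgebra.re_C, QuadraticAlgebra.re_mul, QuadraticAlgebra.re_sub,
        QuadraticAlgebra.im_sub]
      field_simp
      ring
    · simp only [QuadraticAlgebra.im_C, QuadraticAlgebra.im_mul, QuadraticAlgebra.re_sub,
        QuadraticAlgebra.im_sub]
      ring
  have h0 : (QuadraticAlgebra.C (-conjRootsNorm Δ Qa Qb / (4 * (Qa.l * Qb.l) ^ 2)) :
      QSqrt Δ) = 0 ↔ conjRootsNorm Δ Qa Qb = 0 := by
    refine (map_eq_zero f (a := -conjRootsNorm Δ Qa Qb / (4 * (Qa.l * Qb.l) ^ 2))).trans ?_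
    rw [div_eq_zero_iff, neg_eq_zero, or_iff_left]
    positivity
  by_cases h : conjRootsNorm Δ Qa Qb = 0
  · have hc : birSqrt hΔ Qa Qb = OnePoint.infty := if_pos (hd.trans (h0.mpr h))
    rw [bir, hc, if_pos h, OnePoint.map_infty]
  · have hc : birSqrt hΔ Qa Qb = OnePoint.some _ :=
      if_neg fun h' => h (h0.mp (hd.symm.trans h'))
    have hdiv : ∀ u v : ℚ, (QuadraticAlgebra.C u : QSqrt Δ) / QuadraticAlgebra.C v =
        QuadraticAlgebra.C (u / v) := fun u v => (map_div₀ f u v).symm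
    rw [bir, hc, if_neg h, hn, hd, hdiv, OnePoint.map_some, QuadraticAlgebra.re_C]
    congr 1
    field_simp

theorem bir_ne_infty_iff (ha : Qa.disc = Δ) (hb : Qb.disc = Δ) :
    bir hΔ Qa Qb ≠ OnePoint.infty ↔ conjRootsNorm Δ Qa Qb ≠ 0 := by
  rw [bir_eq hΔ ha hb]
  split_ifs with h <;> simp [h]

theorem primeObstructions_eq (ha : Qa.disc = Δ) (hb : Qb.disc = Δ)
    (h : bir hΔ Qa Qb ≠ OnePoint.infty) :
    primeObstructions hΔ Qa Qb = {p | p.hilbert Δ (Qa.l * Qb.l) = -1} := by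
  have h0 := (bir_ne_infty_iff hΔ ha hb).mp h
  have hΔ0 : Δ ≠ 0 := fun h => hΔ (h ▸ IsSquare.zero)
  set N := conjRootsNorm Δ Qa Qb with hN
  set u := Qb.m * Qa.l - Qa.m * Qb.l
  set v := Qa.l + Qb.l
  -- The factor is the norm of 2√Δ(u + v√Δ)/N.
  have e : -4 * Δ * (Qa.l * Qb.l) / N =
      Qa.l * Qb.l * ((2 * Δ * v / N) ^ 2 - Δ * (2 * u / N) ^ 2) := by
    have : N = u ^ 2 - Δ * v ^ 2 := rfl
    field_simp
    rw [this]
    ring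
  have hne : (2 * Δ * v / N) ^ 2 - Δ * (2 * u / N) ^ 2 ≠ 0 := by
    refine right_ne_zero_of_mul (a := Qa.l * Qb.l) (e ▸ ?_)
    have hla := Qfb.l_ne_zero hΔ ha
    have hlb := Qfb.l_ne_zero hΔ hb
    positivity
  ext p
  simp only [primeObstructions, bir_eq hΔ ha hb, Set.mem_ofPred_eq]
  rw [if_neg h0, ← RatPlace.hilbert_mul_norm p hne, ← e]
  simp [← hN]

theorem exists_equivalent_bir_ne_infty (ha : Qa.disc = Δ) (hb : Qb.disc = Δ) :
    ∃ Qb' : Qfb ℚ, Qb.Equivalent Qb' ∧ bir hΔ Qa Qb' ≠ OnePoint.infty := by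
  by_cases h : bir hΔ Qa Qb = OnePoint.infty
  · let C : Matrix.SpecialLinearGroup (Fin 2) ℚ :=
      ⟨!![1, 1; 0, 1], by rw [Matrix.det_fin_two_of]; ring⟩
    have hE : Qb.Equivalent (Qb.comp (Matrix.toLin' (C : Matrix (Fin 2) (Fin 2) ℚ))) := ⟨C, rfl⟩
    refine ⟨_, hE, ?_⟩
    have hla := Qfb.l_ne_zero hΔ ha
    have hlb := Qfb.l_ne_zero hΔ hb
    rw [bir_ne_infty_iff hΔ ha (hE.disc_eq.trans hb)]
    refine sq_sub_mul_sq_ne_zero hΔ fun h1 => ?_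
    -- Since Δ is not a square, bir = ∞ only when both entries vanish; the shear adds 2l_a l_b ≠ 0
    -- to the first.
    have h2 : (Qb.m * Qa.l - Qa.m * Qb.l, Qa.l + Qb.l) = (0, 0) := by
      by_contra h2
      exact (bir_ne_infty_iff hΔ ha hb).mpr (sq_sub_mul_sq_ne_zero hΔ h2) h
    have hlC : Qfb.l (Qb.comp (Matrix.toLin' (C : Matrix (Fin 2) (Fin 2) ℚ))) = Qb.l := by
      rw [Qfb.l_comp]; rfl
    have hmC : Qfb.m (Qb.comp (Matrix.toLin' (C : Matrix (Fin 2) (Fin 2) ℚ))) =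
        2 * Qb.l + Qb.m := by
      rw [Qfb.m_comp]; simp [C]
    simp only [hlC, hmC, Prod.mk.injEq] at h1 h2
    exact mul_ne_zero hla hlb (by linear_combination (h1.1 - h2.1) / 2)
  · exact ⟨Qb, .refl _, h⟩

theorem primeObstructions_eq_of_equivalent {Qa' Qb' : Qfb ℚ} (ha : Qa.disc = Δ)
    (hb : Qb.disc = Δ) (hEa : Qa.Equivalent Qa') (hEb : Qb.Equivalent Qb')
    (h : bir hΔ Qa' Qb' ≠ OnePoint.infty) :
    primeObstructions hΔ Qa' Qb' = {p | p.hilbert Δ (Qa.l * Qb.l) = -1} := by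
  rw [primeObstructions_eq hΔ (hEa.disc_eq.trans ha) (hEb.disc_eq.trans hb) h]
  obtain ⟨u, v, h1, e1⟩ := hEa.exists_l_eq hΔ ha
  obtain ⟨s, t, h2, e2⟩ := hEb.exists_l_eq hΔ hb
  ext p
  rw [Set.mem_ofPred_eq, Set.mem_ofPred_eq, e1, e2, mul_mul_mul_comm, ← mul_assoc,
    RatPlace.hilbert_mul_norm p h2, RatPlace.hilbert_mul_norm p h1]

end Cross

theorem mainTheorem4 (Δ : ℚ) (hΔ : ¬ IsSquare Δ) (Qa Qb : Qfb ℚ)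
    (ha : Qa.disc = Δ) (hb : Qb.disc = Δ) :
    -- The classes of `Qa` and `Qb` have representatives whose cross-ratio is finite,
    (∃ Qa' Qb' : Qfb ℚ, Qa.Equivalent Qa' ∧ Qb.Equivalent Qb' ∧
      bir hΔ Qa' Qb' ≠ OnePoint.infty) ∧
    -- the set of prime obstructions does not depend on the choice of such representatives,
    (∀ Qa' Qb' Qa'' Qb'' : Qfb ℚ, Qa.Equivalent Qa' → Qb.Equivalent Qb' →
      Qa.Equivalent Qa'' → Qb.Equivalent Qb'' →
      bir hΔ Qa' Qb' ≠ OnePoint.infty → bir hΔ Qa'' Qb'' ≠ OnePoint.infty →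
      primeObstructions hΔ Qa' Qb' = primeObstructions hΔ Qa'' Qb'') ∧
    -- and it is empty if and only if the forms are equivalent.
    (∀ Qa' Qb' : Qfb ℚ, Qa.Equivalent Qa' → Qb.Equivalent Qb' →
      bir hΔ Qa' Qb' ≠ OnePoint.infty →
      (Qa.Equivalent Qb ↔ primeObstructions hΔ Qa' Qb' = ∅)) := by
  refine ⟨?_, ?_, ?_⟩
  · obtain ⟨Qb', h, hne⟩ := exists_equivalent_bir_ne_infty hΔ ha hb
    exact ⟨Qa, Qb', .refl _, h, hne⟩
  · intro Qa' Qb' Qa'' Qb'' ha' hb' ha'' hb'' h' h''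
    rw [primeObstructions_eq_of_equivalent hΔ ha hb ha' hb' h',
      primeObstructions_eq_of_equivalent hΔ ha hb ha'' hb'' h'']
  · intro Qa' Qb' ha' hb' h'
    rw [primeObstructions_eq_of_equivalent hΔ ha hb ha' hb' h',
      Qfb.equivalent_iff_conicSolvable hΔ ha hb,
      conicSolvable_iff_everywhereSolvable (fun h0 : Δ = 0 => hΔ (h0 ▸ IsSquare.zero))
        (mul_ne_zero (Qfb.l_ne_zero hΔ ha) (Qfb.l_ne_zero hΔ hb)),
      everywhereSolvable_iff_hilbert, Set.eq_empty_iff_forall_notMem]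
    rfl
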